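/- Let $p$ be a prime, let $\mathbb{Q}_p$ be the additive group of the field of $p$-adic numbers with its Borel $\sigma$-algebra, and let $\alpha$ be a topological automorphism of $\mathbb{Q}_p$, that is, an additive bijection continuous together with its inverse. Write $I$ for the identity map. The characteristic function of a probability distribution $\mu$ on $\mathbb{Q}_p$ is $\hat\mu(y)=\int_{\mathbb{Q}_p} y(x)\,d\mu(x)$, where $y$ runs over all continuous characters of $\mathbb{Q}_p$, i.e. continuous homomorphisms from $\mathbb{Q}_p$ to the unit circle. The conditional distribution of a random variable $L_2$ given $L_1$ is called symmetric if, for almost every value $t$ of $L_1$, the conditional distribution of $L_2$ given $L_1=t$ is invariant under $x\mapsto -x$. Let $\xi_1$ and $\xi_2$ be independent random variables with values in $\mathbb{Q}_p$ and distributions $\mu_1$ and $\mu_2$ whose characteristic functions do not vanish at any point. Assume that the conditional distribution of $L_2=\xi_1+\alpha\xi_2$ given $L_1=\xi_1+\xi_2$ is symmetric. Then the following hold. 1. If $\alpha\neq -I$, then $\mu_1$ and $\mu_2$ are degenerate distributions, i.e. each is concentrated at a single point. 2. If $\alpha=-I$, then $\mu_1=\mu_2$. Moreover, in this case the common distribution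 can be arbitrary: for every probability distribution $\omega$ on $\mathbb{Q}_p$ there exist independent random variables $\xi_1,\xi_2$ with values in $\mathbb{Q}_p$, both with distribution $\omega$, and for any such $\xi_1,\xi_2$ the conditional distribution of $\xi_1-\xi_2$ given $\xi_1+\xi_2$ is symmetric. -/

import Mathlib

open MeasureTheory ProbabilityTheory

/-- The characteristic function `μ̂(y) = ∫ (x, y) dμ(x)` of a distribution `μ` on a topological
abelian group `X`, evaluated at a character `y : X → 𝕋`. It is meant for continuous characters,
i.e. for elements of the character group of `X`. -/
noncomputable def characteristicFunction {X : Type*} [AddCommGroup X] [MeasurableSpace X]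
    (μ : Measure X) (y : AddChar X Circle) : ℂ :=
  ∫ x, (y x : ℂ) ∂μ

/-- The characteristic function of `μ` does not vanish at any element of the character group
(the group of all continuous characters) of `X`. -/
def NonvanishingCharFun {X : Type*} [AddCommGroup X] [TopologicalSpace X] [MeasurableSpace X]
    (μ : Measure X) : Prop :=
  ∀ y : AddChar X Circle, Continuous y → characteristicFunction μ y ≠ 0

/-- A distribution is degenerate if it is concentrated at one point. -/
def IsDegenerate {X : Type*} [MeasurableSpace X] (μ : Measure X) : Prop :=
  ∃ x : X, μ = Measure.dirac x

/-- The conditional distribution of `L₂` given `L₁` is symmetric: for almost every value `t` of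
`L₁`, the (regular) conditional distribution of `L₂` given `L₁ = t` is invariant under
`x ↦ -x`. -/
def CondDistribSymmetric {Ω X : Type*} [MeasurableSpace Ω] [AddCommGroup X] [MeasurableSpace X]
    [StandardBorelSpace X] (L₂ L₁ : Ω → X) (P : Measure Ω) [IsFiniteMeasure P] : Prop :=
  ∀ᵐ t ∂(P.map L₁), (condDistrib L₂ L₁ P t).map (fun x => -x) = condDistrib L₂ L₁ P t

/-!
Independence turns the symmetry of `ξ₁ + α ξ₂` given `ξ₁ + ξ₂` into Heyde's equation
`f (u + v) g (u + α̃ v) = f (u - v) g (u - α̃ v)` for the characteristic functions `f`, `g` of `ξ₁`,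
`ξ₂` and the adjoint `α̃` of `α`. Taking `log |·|` and three successive differences eliminates `g`;
since `2` and, for `α ≠ -I`, also `I + α̃` are surjective, the third difference of `log |f|` with
step `d = α̃ y - y` vanishes for every `y`. As `log |f|` is even, this gives
`log |f (n d)| = n ^ 2 log |f d|`. But `f (p ^ k d) → 1`, because `p ^ k x → 0` in `ℚ_p`, so
`|f (α̃ y - y)| = 1` for all `y`. This says that `α ξ₁ - ξ₁` is almost surely constant, so that
`ξ₁ + α ξ₂` is a function of `ξ₁ + ξ₂`; being conditionally symmetric, it vanishes. Thus
`ξ₁ = -α ξ₂` is independent of itself and therefore degenerate.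

For `α = -I`, adding the two equidistributed pairs `(ξ₁ + ξ₂, ±(ξ₁ - ξ₂))` gives `2 ξ₁` and `2 ξ₂`.
-/

open Filter Topology
open scoped fwdDiff

section FunctionalEquation

variable {Y : Type*} [AddCommGroup Y]

/-- Heyde's functional equation for a pair of functions `f`, `g` on an abelian group. It is meant
for characteristic functions, with `α` the adjoint of the coefficient of the linear form. -/
def HeydeEquation {M : Type*} [Mul M] (α : Y → Y) (f g : Y → M) : Prop :=
  ∀ u v, f (u + v) * g (u + α v) = f (u - v) * g (u - α v)

namespace HeydeEquation

section Nonvanishing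

variable {M : Type*} [MulZeroClass M] [NoZeroDivisors M] {α : Y → Y} {f g : Y → M}

theorem left_ne_zero (h : HeydeEquation α f g) (h2 : Function.Surjective fun y : Y => y + y)
    (hf : f 0 ≠ 0) (hg : ∀ y, g y ≠ 0) (y : Y) : f y ≠ 0 := by
  obtain ⟨v, rfl⟩ := h2 y
  refine left_ne_zero_of_mul (b := g (v + α v)) ?_
  rw [h, sub_self]
  exact mul_ne_zero hf (hg _)

theorem right_ne_zero (h : HeydeEquation α f g) (h2 : Function.Surjective fun y : Y => y + y)
    (hα : Function.Surjective α) (hf : ∀ y, f y ≠ 0) (hg : g 0 ≠ 0) (y : Y) : g y ≠ 0 := by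
  obtain ⟨u, rfl⟩ := h2 y
  obtain ⟨v, rfl⟩ := hα u
  refine right_ne_zero_of_mul (a := f (α v + v)) ?_
  rw [h, sub_self]
  exact mul_ne_zero (hf _) hg

end Nonvanishing

theorem fwdDiff_fwdDiff_fwdDiff_eq_zero {A : Type*} [AddCommGroup A] {α : Y →+ Y} {φ ψ : Y → A}
    (h : ∀ u v, φ (u + v) + ψ (u + α v) = φ (u - v) + ψ (u - α v)) (k l m : Y) :
    Δ_[α l - l] (Δ_[m + m] (Δ_[k + α k] φ)) = 0 := by
  -- Shifting `(u, v)` by `(α k, k)`, `(m, m)` and `(α l, -l)` fixes `u - α v`, `u - v` and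
  -- `u + α v` respectively, so each of the three differences eliminates one term.
  have hk : ∀ u v, Δ_[k + α k] φ (u + v) + Δ_[α k + α k] ψ (u + α v) = Δ_[α k - k] φ (u - v) := by
    intro u v
    have h₁ := h (u + α k) (v + k)
    rw [map_add, show u + α k + (v + k) = u + v + (k + α k) by abel,
      show u + α k + (α v + α k) = u + α v + (α k + α k) by abel,
      show u + α k - (v + k) = u - v + (α k - k) by abel,
      show u + α k - (α v + α k) = u - α v by abel] at h₁
    simp only [fwdDiff]
    linear_combination (norm := abel) h₁ - h u v
  have hm : ∀ u v, Δ_[m + m] (Δ_[k + α k] φ) (u + v) =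
      -Δ_[m + α m] (Δ_[α k + α k] ψ) (u + α v) := by
    intro u v
    have h₁ := hk (u + m) (v + m)
    rw [map_add, show u + m + (v + m) = u + v + (m + m) by abel,
      show u + m + (α v + α m) = u + α v + (m + α m) by abel,
      show u + m - (v + m) = u - v by abel] at h₁
    rw [fwdDiff, fwdDiff.eq_def (m + α m)]
    linear_combination (norm := abel) h₁ - hk u v
  ext x
  have h₁ := hm (x + α l) (-l)
  have h₂ := hm x 0
  rw [map_neg, show x + α l + -l = x + (α l - l) by abel, add_neg_cancel_right] at h₁
  rw [map_zero, add_zero] at h₂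
  rw [fwdDiff, h₁, h₂, sub_self, Pi.zero_apply]

end HeydeEquation

theorem map_nsmul_eq_sq_nsmul_of_fwdDiff_iter_three_eq_zero {A : Type*} [AddCommGroup A]
    {φ : Y → A} {d : Y} (hφ : Δ_[d] ^[3] φ = 0) (h0 : φ 0 = 0) (heven : φ (-d) = φ d) (n : ℕ) :
    φ (n • d) = n ^ 2 • φ d := by
  have hconst : ∀ n : ℕ, Δ_[d] (Δ_[d] φ) (-d + n • d) = 2 • φ d := by
    intro n
    induction n with
    | zero => simp [fwdDiff, h0, heven, two_nsmul]
    | succ n ih =>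
      rw [← ih, succ_nsmul, ← add_assoc]
      exact sub_eq_zero.1 (congrFun hφ _)
  have hrec : ∀ n : ℕ, φ ((n + 2) • d) = 2 • φ ((n + 1) • d) - φ (n • d) + 2 • φ d := by
    intro n
    have := hconst (n + 1)
    simp only [fwdDiff, show -d + (n + 1) • d = n • d by module,
      show n • d + d = (n + 1) • d by module, show (n + 1) • d + d = (n + 2) • d by module] at this
    rw [← this]
    abel
  induction n using Nat.twoStepInduction with
  | zero => simp [h0]
  | one => simp
  | more n ih₀ ih₁ =>
    rw [hrec, ih₀, ih₁]
    module

theorem map_eq_zero_of_tendsto_nsmul {φ : Y → ℝ} {d : Y} (hφ : Δ_[d] ^[3] φ = 0) (h0 : φ 0 = 0)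
    (heven : φ (-d) = φ d) {m : ℕ → ℕ} (hm : ∀ k, m k ≠ 0)
    (hlim : Tendsto (fun k => φ (m k • d)) atTop (𝓝 0)) : φ d = 0 := by
  have hle : ∀ k, |φ d| ≤ |φ (m k • d)| := fun k => by
    rw [map_nsmul_eq_sq_nsmul_of_fwdDiff_iter_three_eq_zero hφ h0 heven, abs_nsmul]
    exact le_self_nsmul (abs_nonneg _) (pow_ne_zero 2 (hm k))
  exact abs_nonpos_iff.1 (ge_of_tendsto' (by simpa using hlim.abs) hle)

theorem HeydeEquation.norm_map_sub_eq_one {𝕜 : Type*} [NormedDivisionRing 𝕜] {α : Y →+ Y}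
    {f g : Y → 𝕜} (h : HeydeEquation α f g) (hf : ∀ y, f y ≠ 0) (hg : ∀ y, g y ≠ 0)
    (h0 : f 0 = 1) (heven : ∀ y, ‖f (-y)‖ = ‖f y‖) {m : ℕ → ℕ} (hm : ∀ k, m k ≠ 0)
    (hlim : ∀ y, Tendsto (fun k => f (m k • y)) atTop (𝓝 1))
    (h2 : Function.Surjective fun y : Y => y + y) (hα : Function.Surjective fun y => y + α y)
    (y : Y) : ‖f (α y - y)‖ = 1 := by
  set φ : Y → ℝ := fun y => Real.log ‖f y‖ with hφ
  have hlog : ∀ u v, φ (u + v) + Real.log ‖g (u + α v)‖ =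
      φ (u - v) + Real.log ‖g (u - α v)‖ := fun u v => by
    simp only [hφ, ← Real.log_mul (norm_ne_zero_iff.2 (hf _)) (norm_ne_zero_iff.2 (hg _)),
      ← norm_mul, h u v]
  obtain ⟨k, hk⟩ := hα (α y - y)
  obtain ⟨l, hl⟩ := h2 (α y - y)
  have hthird : Δ_[α y - y] ^[3] φ = 0 := by
    have := fwdDiff_fwdDiff_fwdDiff_eq_zero (ψ := fun z => Real.log ‖g z‖) hlog k y l
    rwa [show k + α k = _ from hk, show l + l = _ from hl] at this
  have hzero : φ (α y - y) = 0 :=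
    map_eq_zero_of_tendsto_nsmul hthird (by simp [hφ, h0]) (congrArg Real.log (heven _)) hm
      (by simpa using (hlim (α y - y)).norm.log (by simp))
  exact Real.eq_one_of_pos_of_log_eq_zero (norm_pos_iff.2 (hf _)) hzero

end FunctionalEquation

section CharacterGroup

/-- The character group of a topological abelian group `X`, written additively: the continuous
characters `X → 𝕋` as a subgroup of all characters. -/
noncomputable def characterGroup (X : Type*) [AddCommGroup X] [TopologicalSpace X] :
    AddSubgroup (AddChar X Circle) where
  carrier := {y | Continuous y}
  add_mem' hy hz := Continuous.mul hy hz
  zero_mem' := continuous_const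
  neg_mem' {y} hy := Continuous.congr (Continuous.inv hy) fun x => (y.neg_apply' x).symm

variable {X Z : Type*} [AddCommGroup X] [TopologicalSpace X] [AddCommGroup Z] [TopologicalSpace Z]

theorem characterGroup.continuous_coe (y : characterGroup X) : Continuous fun x => (y.1 x : ℂ) :=
  continuous_subtype_val.comp y.2

/-- The adjoint `y ↦ y ∘ α` of a continuous homomorphism `α`, acting on character groups. -/
noncomputable def characterGroup.adjoint (α : X →ₜ+ Z) :
    characterGroup Z →+ characterGroup X where
  toFun y := ⟨y.1.compAddMonoidHom α, y.2.comp α.continuous_toFun⟩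
  map_zero' := rfl
  map_add' _ _ := rfl

theorem characterGroup.adjoint_apply (α : X →ₜ+ Z) (y : characterGroup Z) (x : X) :
    (characterGroup.adjoint α y).1 x = y.1 (α x) := rfl

theorem characterGroup.adjoint_surjective {α : X →ₜ+ Z} (hα : IsHomeomorph α) :
    Function.Surjective (characterGroup.adjoint α) := by
  intro y
  let e : X ≃+ Z := AddEquiv.ofBijective α hα.bijective
  refine ⟨⟨y.1.compAddMonoidHom e.symm, y.2.comp ?_⟩, Subtype.ext (DFunLike.ext _ _ fun x => ?_)⟩
  · exact (e.toEquiv.toHomeomorphOfIsInducing hα.isInducing).symm.continuous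
  · exact congrArg y.1 (e.symm_apply_apply x)

theorem characterGroup.add_self_surjective [IsTopologicalAddGroup X]
    (h2 : IsHomeomorph fun x : X => x + x) :
    Function.Surjective fun y : characterGroup X => y + y := by
  intro y
  obtain ⟨z, hz⟩ := adjoint_surjective
    (α := ContinuousAddMonoidHom.id X + ContinuousAddMonoidHom.id X) h2 y
  refine ⟨z, ?_⟩
  rw [← hz]
  exact Subtype.ext (DFunLike.ext _ _ fun x => (z.1.map_add_eq_mul x x).symm)

theorem characterGroup.add_adjoint_surjective [IsTopologicalAddGroup X] {α : X →ₜ+ X}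
    (hα : IsHomeomorph fun x => x + α x) :
    Function.Surjective fun y => y + characterGroup.adjoint α y := by
  intro y
  obtain ⟨z, hz⟩ := adjoint_surjective (α := ContinuousAddMonoidHom.id X + α) hα y
  refine ⟨z, ?_⟩
  rw [← hz]
  exact Subtype.ext (DFunLike.ext _ _ fun x => (z.1.map_add_eq_mul x (α x)).symm)

theorem exists_injective_addChar_addCircle_rat :
    ∃ e : AddChar (AddCircle (1 : ℚ)) Circle, Function.Injective e := by
  let c : AddCircle (1 : ℚ) →+ AddCircle (1 : ℝ) :=
    QuotientAddGroup.map _ _ (Rat.castHom ℝ : ℚ →+ ℝ) (by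
      simp only [AddSubgroup.zmultiples_le, AddSubgroup.mem_comap, AddMonoidHom.coe_coe,
        map_one, AddSubgroup.mem_zmultiples])
  refine ⟨AddCircle.toCircle_addChar.compAddMonoidHom c,
    (AddCircle.injective_toCircle one_ne_zero).comp
      ((injective_iff_map_eq_zero c).2 fun q hq => ?_)⟩
  induction q using QuotientAddGroup.induction_on with | H q =>
  obtain ⟨n, hn⟩ := (QuotientAddGroup.eq_zero_iff _).1 hq
  refine (QuotientAddGroup.eq_zero_iff _).2 ⟨n, ?_⟩
  simp only [zsmul_eq_mul, mul_one, AddMonoidHom.coe_coe, eq_ratCast] at hn ⊢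
  exact_mod_cast hn

theorem exists_characterGroup_apply_ne_one [NonarchimedeanAddGroup X] [T1Space X] {x : X}
    (hx : x ≠ 0) : ∃ y : characterGroup X, y.1 x ≠ 1 := by
  obtain ⟨U, hU⟩ := NonarchimedeanAddGroup.is_nonarchimedean _ (isOpen_ne.mem_nhds hx.symm)
  obtain ⟨c, hc⟩ := CharacterModule.exists_character_apply_ne_zero_of_ne_zero
    (a := (x : X ⧸ U.toAddSubgroup)) (fun h => hU ((QuotientAddGroup.eq_zero_iff x).1 h) rfl)
  have := QuotientAddGroup.discreteTopology U.isOpen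
  obtain ⟨e, he⟩ := exists_injective_addChar_addCircle_rat
  refine ⟨⟨e.compAddMonoidHom (AddMonoidHom.comp c (QuotientAddGroup.mk' U.toAddSubgroup)), ?_⟩, ?_⟩
  · exact (continuous_of_discreteTopology (f := fun q => e (c q))).comp continuous_quot_mk
  · exact fun h => hc (he (h.trans e.map_zero_eq_one.symm))

end CharacterGroup

section Degenerate

variable {Ω X : Type*} [MeasurableSpace Ω] [MeasurableSpace X] [MeasurableSingletonClass X]

theorem isDegenerate_map_iff {P : Measure Ω} [IsProbabilityMeasure P] {ξ : Ω → X}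
    (hξ : AEMeasurable ξ P) : IsDegenerate (P.map ξ) ↔ ∃ x, ∀ᵐ ω ∂P, ξ ω = x := by
  refine exists_congr fun x => ⟨fun h => ?_, fun h => ?_⟩
  · refine ae_of_ae_map (p := fun z => z = x) hξ ?_
    rw [h]
    exact (ae_dirac_iff (measurableSet_singleton x)).2 rfl
  · rw [Measure.map_congr h]
    simp

theorem isDegenerate_iff {μ : Measure X} [IsProbabilityMeasure μ] :
    IsDegenerate μ ↔ ∃ x₀, ∀ᵐ x ∂μ, x = x₀ := by
  simpa using isDegenerate_map_iff (P := μ) aemeasurable_id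

theorem isDegenerate_of_forall_ae_eq_const [TopologicalSpace X] [HereditarilyLindelofSpace X]
    {ι Z : Type*} [TopologicalSpace Z] [T1Space Z] {μ : Measure X} [IsProbabilityMeasure μ]
    {F : ι → X → Z} (hF : ∀ i, Continuous (F i)) (hsep : ∀ x x', (∀ i, F i x = F i x') → x = x')
    (hconst : ∀ i, ∃ c, ∀ᵐ x ∂μ, F i x = c) : IsDegenerate μ := by
  choose c hc using hconst
  have hsupp : ∀ x ∈ μ.support, ∀ i, F i x = c i := fun x hx i =>
    Measure.support_subset_of_isClosed (isClosed_singleton.preimage (hF i)) (hc i) hx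
  obtain ⟨x₀, hx₀⟩ := Measure.nonempty_support (NeZero.ne μ)
  refine isDegenerate_iff.2 ⟨x₀, ?_⟩
  filter_upwards [Measure.support_mem_ae] with x hx
  exact hsep x x₀ fun i => (hsupp x hx i).trans (hsupp x₀ hx₀ i).symm

end Degenerate

section ZeroOne

variable {Ω X : Type*} [MeasurableSpace Ω] [MeasurableSpace X] [StandardBorelSpace X]
  {P : Measure Ω} [IsProbabilityMeasure P] {η : Ω → X}

theorem isDegenerate_of_indepFun_self (hη : Measurable η) (h : IndepFun η η P) :
    IsDegenerate (P.map η) := by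
  have := Measure.isProbabilityMeasure_map (μ := P) hη.aemeasurable
  have : IsZeroOneMeasure (P.map η) := ⟨fun s hs => by
    rw [Measure.map_apply hη hs]
    exact measure_eq_zero_or_one_of_indepSet_self
      ((indepFun_iff_indepSet_preimage hη hη).1 h s s hs hs)⟩
  exact IsZeroOneMeasure.exists_eq_dirac

theorem isDegenerate_of_indepFun_of_ae_eq_comp {Z : Type*} [MeasurableSpace Z] {ξ : Ω → Z}
    (hη : Measurable η) (hind : IndepFun ξ η P) {g : Z → X} (hg : Measurable g)
    (h : ∀ᵐ ω ∂P, η ω = g (ξ ω)) : IsDegenerate (P.map η) :=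
  isDegenerate_of_indepFun_self hη
    ((hind.comp hg measurable_id).congr (h.mono fun _ => Eq.symm) .rfl)

end ZeroOne

section ConditionalSymmetry

variable {Ω X : Type*} [MeasurableSpace Ω] [AddCommGroup X] [MeasurableSpace X]
  [StandardBorelSpace X] {P : Measure Ω} [IsFiniteMeasure P] {L₁ L₂ ξ₁ ξ₂ : Ω → X}

theorem condDistribSymmetric_iff_identDistrib [MeasurableNeg X]
    (hL₁ : AEMeasurable L₁ P) (hL₂ : AEMeasurable L₂ P) :
    CondDistribSymmetric L₂ L₁ P ↔
      IdentDistrib (fun ω => (L₁ ω, L₂ ω)) (fun ω => (L₁ ω, -L₂ ω)) P P := by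
  have hneg : condDistrib (Neg.neg ∘ L₂) L₁ P =ᵐ[P.map L₁] (condDistrib L₂ L₁ P).map Neg.neg :=
    condDistrib_comp L₁ hL₂ measurable_neg
  calc
    CondDistribSymmetric L₂ L₁ P
    _ ↔ condDistrib (Neg.neg ∘ L₂) L₁ P =ᵐ[P.map L₁] condDistrib L₂ L₁ P := by
      refine eventually_congr (hneg.mono fun t ht => ?_)
      rw [ht, Kernel.map_apply _ measurable_neg]
    _ ↔ P.map (fun ω => (L₁ ω, -L₂ ω)) = P.map L₁ ⊗ₘ condDistrib L₂ L₁ P :=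
      condDistrib_ae_eq_iff_measure_eq_compProd L₁ hL₂.neg _
    _ ↔ _ := by
      rw [compProd_map_condDistrib hL₂, eq_comm]
      exact ⟨fun h => ⟨by fun_prop, by fun_prop, h⟩, fun h => h.map_eq⟩

theorem CondDistribSymmetric.ae_eq_neg [MeasurableNeg X]
    (h : CondDistribSymmetric L₂ L₁ P) (hL₁ : AEMeasurable L₁ P)
    (hL₂ : AEMeasurable L₂ P) {g : X → X} (hg : Measurable g) (hfun : ∀ᵐ ω ∂P, L₂ ω = g (L₁ ω)) :
    ∀ᵐ ω ∂P, L₂ ω = -L₂ ω := by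
  have hneg := ((condDistribSymmetric_iff_identDistrib hL₁ hL₂).1 h).ae_mem_snd
    (measurableSet_eq_fun measurable_snd (hg.comp measurable_fst)) hfun
  filter_upwards [hfun, hneg] with ω hω hω'
  exact hω.trans hω'.symm

theorem condDistribSymmetric_sub_add [MeasurableAdd₂ X] [MeasurableNeg X]
    (h₁ : AEMeasurable ξ₁ P) (h₂ : AEMeasurable ξ₂ P) (hind : IndepFun ξ₁ ξ₂ P)
    (hlaw : P.map ξ₁ = P.map ξ₂) :
    CondDistribSymmetric (fun ω => ξ₁ ω - ξ₂ ω) (fun ω => ξ₁ ω + ξ₂ ω) P := by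
  have hswap : IdentDistrib (fun ω => (ξ₁ ω, ξ₂ ω)) (fun ω => (ξ₂ ω, ξ₁ ω)) P P :=
    ⟨h₁.prodMk h₂, h₂.prodMk h₁, by
      rw [(indepFun_iff_map_prod_eq_prod_map_map h₁ h₂).1 hind,
        (indepFun_iff_map_prod_eq_prod_map_map h₂ h₁).1 hind.symm, hlaw]⟩
  have := hswap.comp (u := fun z : X × X => (z.1 + z.2, z.1 - z.2)) (by fun_prop)
  refine (condDistribSymmetric_iff_identDistrib (by fun_prop) (by fun_prop)).2 ?_
  simpa only [Function.comp_def, neg_sub, add_comm] using this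

theorem CondDistribSymmetric.map_eq_map [MeasurableAdd₂ X] [MeasurableNeg X]
    (h : CondDistribSymmetric (fun ω => ξ₁ ω - ξ₂ ω) (fun ω => ξ₁ ω + ξ₂ ω) P)
    (h₁ : AEMeasurable ξ₁ P) (h₂ : AEMeasurable ξ₂ P)
    (h2 : Function.Injective fun x : X => x + x) : P.map ξ₁ = P.map ξ₂ := by
  have hdouble : Measurable fun x : X => x + x := by fun_prop
  have hsum := ((condDistribSymmetric_iff_identDistrib (by fun_prop) (by fun_prop)).1 h).comp
    (u := fun z : X × X => z.1 + z.2) (by fun_prop)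
  refine (hdouble.measurableEmbedding h2).map_injective ?_
  rw [AEMeasurable.map_map_of_aemeasurable hdouble.aemeasurable h₁,
    AEMeasurable.map_map_of_aemeasurable hdouble.aemeasurable h₂]
  convert hsum.map_eq using 2
  · ext ω
    exact (add_add_sub_cancel _ _ _).symm
  · ext ω
    simp only [Function.comp_apply, neg_sub]
    abel

end ConditionalSymmetry

section CharacteristicFunction

variable {X : Type*} [AddCommGroup X] [MeasurableSpace X]

theorem characteristicFunction_zero (μ : Measure X) [IsProbabilityMeasure μ] :
    characteristicFunction μ 0 = 1 := by
  simp [characteristicFunction]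

theorem norm_characteristicFunction_neg (μ : Measure X) (y : AddChar X Circle) :
    ‖characteristicFunction μ (-y)‖ = ‖characteristicFunction μ y‖ := by
  have hconj : characteristicFunction μ (-y) = starRingEnd ℂ (characteristicFunction μ y) := by
    simp only [characteristicFunction, AddChar.neg_apply', Circle.coe_inv_eq_conj, integral_conj]
  rw [hconj, RCLike.norm_conj]

theorem exists_ae_eq_of_norm_characteristicFunction_eq_one {μ : Measure X}
    [IsProbabilityMeasure μ] {y : AddChar X Circle} (h : ‖characteristicFunction μ y‖ = 1) :
    ∃ c : ℂ, ∀ᵐ x ∂μ, (y x : ℂ) = c := by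
  have hle : ∀ᵐ x ∂μ, ‖(y x : ℂ)‖ ≤ 1 := .of_forall fun _ => (Circle.norm_coe _).le
  refine (ae_eq_const_or_norm_integral_lt_of_norm_le_const hle).elim (fun hc => ⟨_, hc⟩)
    fun hlt => absurd h ?_
  simpa [characteristicFunction] using hlt.ne

theorem characteristicFunction_map [TopologicalSpace X] [OpensMeasurableSpace X] {Ω : Type*}
    [MeasurableSpace Ω] {P : Measure Ω} {ξ : Ω → X} (hξ : AEMeasurable ξ P)
    (y : characterGroup X) : characteristicFunction (P.map ξ) y = ∫ ω, (y.1 (ξ ω) : ℂ) ∂P :=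
  integral_map hξ (characterGroup.continuous_coe y).aestronglyMeasurable

end CharacteristicFunction

section TopologicalGroup

variable {X : Type*} [AddCommGroup X] [TopologicalSpace X] [MeasurableSpace X] [BorelSpace X]

theorem tendsto_characteristicFunction_nsmul (μ : Measure X) [IsProbabilityMeasure μ] {m : ℕ → ℕ}
    (hX : ∀ x : X, Tendsto (fun k => m k • x) atTop (𝓝 0)) (y : characterGroup X) :
    Tendsto (fun k => characteristicFunction μ (m k • y : characterGroup X)) atTop (𝓝 1) := by
  rw [← characteristicFunction_zero μ]
  refine tendsto_integral_of_dominated_convergence (fun _ => 1)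
    (fun k => (characterGroup.continuous_coe (m k • y)).aestronglyMeasurable)
    (integrable_const 1) (fun k => .of_forall fun x => (Circle.norm_coe _).le)
    (.of_forall fun x => ?_)
  have hlim := ((characterGroup.continuous_coe y).tendsto 0).comp (hX x)
  simpa [Function.comp_def, AddChar.map_nsmul_eq_pow, AddChar.nsmul_apply] using hlim

theorem isDegenerate_of_norm_characteristicFunction_eq_one [NonarchimedeanAddGroup X]
    [T1Space X] [HereditarilyLindelofSpace X] {μ : Measure X} [IsProbabilityMeasure μ]
    (h : ∀ y : characterGroup X, ‖characteristicFunction μ y‖ = 1) : IsDegenerate μ := by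
  refine isDegenerate_of_forall_ae_eq_const (F := fun (y : characterGroup X) x => (y.1 x : ℂ))
    characterGroup.continuous_coe (fun x x' hx => ?_)
    fun y => exists_ae_eq_of_norm_characteristicFunction_eq_one (h y)
  by_contra hne
  obtain ⟨y, hy⟩ := exists_characterGroup_apply_ne_one (sub_ne_zero.2 hne)
  refine hy ?_
  rw [AddChar.map_sub_eq_div, Circle.ext (hx y), div_self']

variable {Ω : Type*} [MeasurableSpace Ω] {P : Measure Ω} {ξ₁ ξ₂ : Ω → X}

theorem CondDistribSymmetric.heydeEquation [IsTopologicalAddGroup X] [PolishSpace X]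
    [IsFiniteMeasure P] {α : X →ₜ+ X}
    (hsymm : CondDistribSymmetric (fun ω => ξ₁ ω + α (ξ₂ ω)) (fun ω => ξ₁ ω + ξ₂ ω) P)
    (h₁ : AEMeasurable ξ₁ P) (h₂ : AEMeasurable ξ₂ P) (hind : IndepFun ξ₁ ξ₂ P) :
    HeydeEquation (characterGroup.adjoint α)
      (fun y : characterGroup X => characteristicFunction (P.map ξ₁) y)
      (fun y : characterGroup X => characteristicFunction (P.map ξ₂) y) := by
  intro u v
  have hα : Measurable α := α.continuous_toFun.measurable
  have hmeas : ∀ y : characterGroup X, Measurable fun x => (y.1 x : ℂ) := fun y =>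
    (characterGroup.continuous_coe y).measurable
  have hL₂ : AEMeasurable (fun ω => ξ₁ ω + α (ξ₂ ω)) P := h₁.add (hα.comp_aemeasurable h₂)
  have hprod : ∀ y z : characterGroup X, characteristicFunction (P.map ξ₁) y *
      characteristicFunction (P.map ξ₂) z = ∫ ω, (y.1 (ξ₁ ω) : ℂ) * z.1 (ξ₂ ω) ∂P := by
    intro y z
    rw [characteristicFunction_map h₁, characteristicFunction_map h₂]
    exact ((hind.comp (hmeas y) (hmeas z)).integral_fun_mul_eq_mul_integral
      ((hmeas y).comp_aemeasurable h₁).aestronglyMeasurable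
      ((hmeas z).comp_aemeasurable h₂).aestronglyMeasurable).symm
  have hL := (((condDistribSymmetric_iff_identDistrib (h₁.add h₂) hL₂).1 hsymm).comp
    (u := fun z : X × X => (u.1 z.1 : ℂ) * v.1 z.2)
    (((hmeas u).comp measurable_fst).mul ((hmeas v).comp measurable_snd))).integral_eq
  rw [hprod, hprod]
  convert hL using 3 with ω ω
  · simp only [characterGroup.adjoint_apply, AddSubgroup.coe_add, AddChar.add_apply,
      AddChar.map_add_eq_mul, Circle.coe_mul, Function.comp_apply, Pi.add_apply]
    ring
  · simp only [characterGroup.adjoint_apply, AddSubgroup.coe_sub, AddChar.sub_apply',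
      AddChar.map_add_eq_mul, AddChar.map_neg_eq_inv, Circle.coe_mul, Circle.coe_div,
      Circle.coe_inv, Function.comp_apply, Pi.add_apply]
    field

end TopologicalGroup

section HeydeTheorem

variable {X : Type*} [AddCommGroup X] [TopologicalSpace X] [PolishSpace X] [MeasurableSpace X]
  [BorelSpace X] {Ω : Type*} [MeasurableSpace Ω] {P : Measure Ω} [IsProbabilityMeasure P]
  {ξ₁ ξ₂ : Ω → X}

theorem CondDistribSymmetric.characteristicFunction_ne_zero [IsTopologicalAddGroup X] {α : X →ₜ+ X}
    (hsymm : CondDistribSymmetric (fun ω => ξ₁ ω + α (ξ₂ ω)) (fun ω => ξ₁ ω + ξ₂ ω) P)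
    (h₁ : AEMeasurable ξ₁ P) (h₂ : AEMeasurable ξ₂ P) (hind : IndepFun ξ₁ ξ₂ P)
    (h2 : IsHomeomorph fun x : X => x + x) (hα : IsHomeomorph α)
    (hne : NonvanishingCharFun (P.map ξ₁) ∨ NonvanishingCharFun (P.map ξ₂)) :
    (∀ y : characterGroup X, characteristicFunction (P.map ξ₁) y ≠ 0) ∧
      ∀ y : characterGroup X, characteristicFunction (P.map ξ₂) y ≠ 0 := by
  have := Measure.isProbabilityMeasure_map h₁
  have := Measure.isProbabilityMeasure_map h₂
  have heq := hsymm.heydeEquation h₁ h₂ hind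
  have hdouble := characterGroup.add_self_surjective h2
  have hzero (ν : Measure X) [IsProbabilityMeasure ν] :
      characteristicFunction ν (0 : characterGroup X) ≠ 0 := by
    simp [characteristicFunction_zero]
  rcases hne with hne | hne
  · have hf (y : characterGroup X) := hne y y.2
    exact ⟨hf, heq.right_ne_zero hdouble (characterGroup.adjoint_surjective hα) hf (hzero _)⟩
  · have hg (y : characterGroup X) := hne y y.2
    exact ⟨heq.left_ne_zero hdouble (hzero _) hg, hg⟩

theorem CondDistribSymmetric.ae_map_sub_eq_const [NonarchimedeanAddGroup X] {α : X →ₜ+ X}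
    (hsymm : CondDistribSymmetric (fun ω => ξ₁ ω + α (ξ₂ ω)) (fun ω => ξ₁ ω + ξ₂ ω) P)
    (h₁ : AEMeasurable ξ₁ P) (h₂ : AEMeasurable ξ₂ P) (hind : IndepFun ξ₁ ξ₂ P)
    (h2 : IsHomeomorph fun x : X => x + x) {m : ℕ → ℕ} (hm : ∀ k, m k ≠ 0)
    (hX : ∀ x : X, Tendsto (fun k => m k • x) atTop (𝓝 0)) (hα : IsHomeomorph fun x => x + α x)
    (hf : ∀ y : characterGroup X, characteristicFunction (P.map ξ₁) y ≠ 0)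
    (hg : ∀ y : characterGroup X, characteristicFunction (P.map ξ₂) y ≠ 0) :
    ∃ a, ∀ᵐ ω ∂P, α (ξ₁ ω) - ξ₁ ω = a := by
  have := Measure.isProbabilityMeasure_map h₁
  have hη : AEMeasurable (fun ω => α (ξ₁ ω) - ξ₁ ω) P :=
    (α.continuous_toFun.measurable.comp_aemeasurable h₁).sub h₁
  have := Measure.isProbabilityMeasure_map hη
  refine (isDegenerate_map_iff hη).1
    (isDegenerate_of_norm_characteristicFunction_eq_one fun y => ?_)
  have hnorm := (hsymm.heydeEquation h₁ h₂ hind).norm_map_sub_eq_one hf hg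
    (characteristicFunction_zero _) (fun _ => norm_characteristicFunction_neg _ _) hm
    (tendsto_characteristicFunction_nsmul _ hX) (characterGroup.add_self_surjective h2)
    (characterGroup.add_adjoint_surjective hα) y
  rw [characteristicFunction_map h₁] at hnorm
  rw [characteristicFunction_map hη, ← hnorm]
  simp only [AddSubgroup.coe_sub, AddChar.sub_apply', characterGroup.adjoint_apply,
    AddChar.map_sub_eq_div]

theorem CondDistribSymmetric.isDegenerate [IsTopologicalAddGroup X] {α : X →ₜ+ X}
    (hsymm : CondDistribSymmetric (fun ω => ξ₁ ω + α (ξ₂ ω)) (fun ω => ξ₁ ω + ξ₂ ω) P)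
    (h₁ : Measurable ξ₁) (h₂ : Measurable ξ₂) (hind : IndepFun ξ₁ ξ₂ P)
    (h2 : Function.Injective fun x : X => x + x) (hα : Function.Injective α)
    (hconst : ∃ a, ∀ᵐ ω ∂P, α (ξ₁ ω) - ξ₁ ω = a) :
    IsDegenerate (P.map ξ₁) ∧ IsDegenerate (P.map ξ₂) := by
  have hαm : Measurable α := α.continuous_toFun.measurable
  obtain ⟨a, ha⟩ := hconst
  have hL₂ : ∀ᵐ ω ∂P, ξ₁ ω + α (ξ₂ ω) = α (ξ₁ ω + ξ₂ ω) - a := by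
    filter_upwards [ha] with ω hω
    rw [← hω, map_add]
    abel
  have hneg := hsymm.ae_eq_neg (by fun_prop) (by fun_prop) (hαm.sub_const a) hL₂
  have hξ₁ : ∀ᵐ ω ∂P, ξ₁ ω = -α (ξ₂ ω) := by
    filter_upwards [hneg] with ω hω
    refine eq_neg_of_add_eq_zero_left (h2 ?_)
    simpa using eq_neg_iff_add_eq_zero.1 hω
  have hdeg : IsDegenerate (P.map ξ₁) :=
    isDegenerate_of_indepFun_of_ae_eq_comp h₁ hind.symm hαm.neg hξ₁
  refine ⟨hdeg, (isDegenerate_map_iff h₂.aemeasurable).2 ?_⟩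
  obtain ⟨b, hb⟩ := (isDegenerate_map_iff h₁.aemeasurable).1 hdeg
  have hαξ₂ : ∀ᵐ ω ∂P, α (ξ₂ ω) = -b := by
    filter_upwards [hξ₁, hb] with ω hω hbω
    rw [← hbω, hω, neg_neg]
  obtain ⟨ω₀, hω₀⟩ := hαξ₂.exists
  exact ⟨ξ₂ ω₀, hαξ₂.mono fun ω hω => hα (hω.trans hω₀.symm)⟩

end HeydeTheorem

theorem exists_indepFun_map_eq {X : Type*} [MeasurableSpace X] (μ ν : Measure X)
    [IsProbabilityMeasure μ] [IsProbabilityMeasure ν] :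
    ∃ (P : Measure (X × X)) (_ : IsProbabilityMeasure P) (ξ₁ ξ₂ : X × X → X), Measurable ξ₁ ∧
      Measurable ξ₂ ∧ IndepFun ξ₁ ξ₂ P ∧ P.map ξ₁ = μ ∧ P.map ξ₂ = ν :=
  ⟨μ.prod ν, inferInstance, Prod.fst, Prod.snd, measurable_fst, measurable_snd,
    indepFun_prod measurable_id measurable_id, by simp, by simp⟩

universe u

theorem proposition2p9_general {X : Type u} [AddCommGroup X] [TopologicalSpace X]
    [NonarchimedeanAddGroup X] [PolishSpace X] [MeasurableSpace X] [BorelSpace X] (α : X ≃ₜ+ X)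
    (h2 : IsHomeomorph fun x : X => x + x) {m : ℕ → ℕ} (hm : ∀ k, m k ≠ 0)
    (hX : ∀ x : X, Tendsto (fun k => m k • x) atTop (𝓝 0)) :
    (∀ (Ω : Type*) [MeasurableSpace Ω] (P : Measure Ω) [IsProbabilityMeasure P]
        (ξ₁ ξ₂ : Ω → X), Measurable ξ₁ → Measurable ξ₂ →
        CondDistribSymmetric (fun ω => ξ₁ ω + α (ξ₂ ω)) (fun ω => ξ₁ ω + ξ₂ ω) P →
          (IsHomeomorph (fun x => x + α x) → IndepFun ξ₁ ξ₂ P →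
            NonvanishingCharFun (P.map ξ₁) ∨ NonvanishingCharFun (P.map ξ₂) →
            IsDegenerate (P.map ξ₁) ∧ IsDegenerate (P.map ξ₂)) ∧
          (⇑α = (fun x => -x) → P.map ξ₁ = P.map ξ₂)) ∧
    (⇑α = (fun x => -x) →
      ∀ (μ : Measure X) [IsProbabilityMeasure μ],
        (∃ (Ω : Type u) (_ : MeasurableSpace Ω) (P : Measure Ω) (_ : IsProbabilityMeasure P)
          (ξ₁ ξ₂ : Ω → X), Measurable ξ₁ ∧ Measurable ξ₂ ∧ IndepFun ξ₁ ξ₂ P ∧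
          P.map ξ₁ = μ ∧ P.map ξ₂ = μ) ∧
        ∀ (Ω : Type*) [MeasurableSpace Ω] (P : Measure Ω) [IsProbabilityMeasure P]
          (ξ₁ ξ₂ : Ω → X), Measurable ξ₁ → Measurable ξ₂ → IndepFun ξ₁ ξ₂ P →
          P.map ξ₁ = μ → P.map ξ₂ = μ →
          CondDistribSymmetric (fun ω => ξ₁ ω + α (ξ₂ ω)) (fun ω => ξ₁ ω + ξ₂ ω) P) := by
  refine ⟨fun Ω _ P _ ξ₁ ξ₂ h₁ h₂ hsymm => ⟨fun hα hind hne => ?_, fun hα => ?_⟩,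
    fun hα μ _ => ⟨⟨X × X, inferInstance, exists_indepFun_map_eq μ μ⟩,
      fun Ω _ P _ ξ₁ ξ₂ h₁ h₂ hind hμ₁ hμ₂ => ?_⟩⟩
  · change CondDistribSymmetric (fun ω => ξ₁ ω + (α : X →ₜ+ X) (ξ₂ ω)) _ P at hsymm
    obtain ⟨hf, hg⟩ := hsymm.characteristicFunction_ne_zero h₁.aemeasurable h₂.aemeasurable hind
      h2 α.toHomeomorph.isHomeomorph hne
    exact hsymm.isDegenerate h₁ h₂ hind h2.injective α.injective
      (hsymm.ae_map_sub_eq_const h₁.aemeasurable h₂.aemeasurable hind h2 hm hX hα hf hg)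
  · simp only [hα, ← sub_eq_add_neg] at hsymm
    exact hsymm.map_eq_map h₁.aemeasurable h₂.aemeasurable h2.injective
  · simp only [hα, ← sub_eq_add_neg]
    exact condDistribSymmetric_sub_add h₁.aemeasurable h₂.aemeasurable hind (hμ₁.trans hμ₂.symm)

section PadicLine

variable {p : ℕ} [Fact p.Prime]

theorem tendsto_padic_pow_nsmul (x : ℚ_[p]) : Tendsto (fun k => p ^ k • x) atTop (𝓝 0) := by
  simpa using (tendsto_pow_atTop_nhds_zero_of_norm_lt_one Padic.norm_p_lt_one).mul_const x

theorem map_padic_eq_map_one_mul {α : ℚ_[p] →+ ℚ_[p]} (hα : Continuous α) (x : ℚ_[p]) :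
    α x = α 1 * x :=
  congrFun (Padic.denseRange_ratCast p |>.equalizer hα (by fun_prop)
    (by ext q; simpa [mul_comm, Rat.smul_def] using map_rat_smul α q (1 : ℚ_[p]))) x

theorem isHomeomorph_padic_add_map (α : ℚ_[p] ≃ₜ+ ℚ_[p]) (hα : ⇑α ≠ fun x => -x) :
    IsHomeomorph fun x => x + α x := by
  have hmul (x : ℚ_[p]) : α x = α 1 * x :=
    map_padic_eq_map_one_mul (α := (α : ℚ_[p] →+ ℚ_[p])) α.continuous x
  have hne : 1 + α 1 ≠ 0 := fun h => hα <| funext fun x => by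
    rw [hmul, eq_neg_of_add_eq_zero_right h, neg_one_mul]
  simpa only [Homeomorph.coe_mulLeft₀, add_mul, one_mul, ← hmul] using
    (Homeomorph.mulLeft₀ _ hne).isHomeomorph

end PadicLine

theorem proposition2p9 (p : ℕ) [Fact p.Prime] [MeasurableSpace ℚ_[p]] [BorelSpace ℚ_[p]]
    (α : ℚ_[p] ≃ₜ+ ℚ_[p]) :
    -- If `α ≠ -I`, both distributions are degenerate; if `α = -I`, they coincide.
    (∀ (Ω : Type*) [MeasurableSpace Ω] (P : Measure Ω) [IsProbabilityMeasure P]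
        (ξ₁ ξ₂ : Ω → ℚ_[p]), Measurable ξ₁ → Measurable ξ₂ → IndepFun ξ₁ ξ₂ P →
        NonvanishingCharFun (P.map ξ₁) → NonvanishingCharFun (P.map ξ₂) →
        CondDistribSymmetric (fun ω => ξ₁ ω + α (ξ₂ ω)) (fun ω => ξ₁ ω + ξ₂ ω) P →
          ((α : ℚ_[p] → ℚ_[p]) ≠ (fun x => -x) →
            IsDegenerate (P.map ξ₁) ∧ IsDegenerate (P.map ξ₂)) ∧
          ((α : ℚ_[p] → ℚ_[p]) = (fun x => -x) → P.map ξ₁ = P.map ξ₂)) ∧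
    -- If `α = -I`, the common distribution `ω` can be arbitrary: independent random variables
    -- with distribution `ω` exist, and any such pair satisfies the symmetry condition.
    ((α : ℚ_[p] → ℚ_[p]) = (fun x => -x) →
      ∀ (μ : Measure ℚ_[p]) [IsProbabilityMeasure μ],
        (∃ (Ω : Type) (_ : MeasurableSpace Ω) (P : Measure Ω) (_ : IsProbabilityMeasure P)
          (ξ₁ ξ₂ : Ω → ℚ_[p]), Measurable ξ₁ ∧ Measurable ξ₂ ∧ IndepFun ξ₁ ξ₂ P ∧
          P.map ξ₁ = μ ∧ P.map ξ₂ = μ) ∧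
        ∀ (Ω : Type*) [MeasurableSpace Ω] (P : Measure Ω) [IsProbabilityMeasure P]
          (ξ₁ ξ₂ : Ω → ℚ_[p]), Measurable ξ₁ → Measurable ξ₂ → IndepFun ξ₁ ξ₂ P →
          P.map ξ₁ = μ → P.map ξ₂ = μ →
          CondDistribSymmetric (fun ω => ξ₁ ω + α (ξ₂ ω)) (fun ω => ξ₁ ω + ξ₂ ω) P) := by
  have hdouble : IsHomeomorph fun x : ℚ_[p] => x + x := by
    simpa only [Homeomorph.coe_mulLeft₀, two_mul] using
      (Homeomorph.mulLeft₀ (2 : ℚ_[p]) two_ne_zero).isHomeomorph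
  have general := proposition2p9_general α hdouble
    (fun k => pow_ne_zero k (Fact.out : p.Prime).ne_zero) tendsto_padic_pow_nsmul
  exact ⟨fun Ω _ P _ ξ₁ ξ₂ h₁ h₂ hind hf _ hsymm => (general.1 Ω P ξ₁ ξ₂ h₁ h₂ hsymm).imp_left
    fun h hα => h (isHomeomorph_padic_add_map α hα) hind (.inl hf), general.2⟩
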